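/- Throughout, $\lambda$ is Lebesgue measure on $\mathbb R$, $|A|=\lambda(A)$, and $L^\infty$ spaces are real. For a compact set $K\subseteq\mathbb R$ of positive measure put $$\pi_K(x)=\lambda([\min K,x]\cap K)\quad(x\in K),\qquad \sigma_K(t)=\min\pi_K^{-1}(t),\qquad E_K=\{t\in[0,|K|]:\#\pi_K^{-1}(t)>1\},$$ $$J_Kf(x)=\int_{[\min K,x]\cap K}f\,d\lambda\quad(x\in K,\ f\in L^\infty(K)),\qquad \|f\|_A=\sup_{x\in K}|J_Kf(x)|.$$ A gap of $K$ is an open interval $(\ell,r)$, $\ell<r$, with $\ell,r\in K$ and $(\ell,r)\cap K=\emptyset$. A lipeomorphism is a bi-Lipschitz homeomorphism. Let $K,M\subseteq\mathbb R$ be compact sets of positive measure and let $\psi:[0,|M|]\to[0,|K|]$ be an increasing lipeomorphism. $K$ and $M$ are called fiber $\psi$-compatible if $\psi(E_M)=E_K$ and, for every $s\in E_M$, the fibers $\pi_M^{-1}(s)$ and $\pi_K^{-1}(\psi(s))$ are order-isomorphic. They are called gap $\psi$-compatible if they are fiber $\psi$-compatible and there are order-isomorphisms $h_s:\pi_M^{-1}(s)\to\pi_K^{-1}(\psi(s))$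 $(s\in E_M)$ and a constant $C\ge1$ such that for every gap $U=(\ell',r')$ of $M$, with $s=\pi_M(\ell')=\pi_M(r')$, $$C^{-1}\le\frac{\lambda(V_{U,h_s})}{\lambda(U)}\le C,\qquad V_{U,h_s}=(h_s(\ell'),h_s(r')).$$ **Corollary 5.5.** Assume that $K$ and $M$ are gap $\psi$-compatible. Let $T:(L^\infty(K),\|\cdot\|_A)\to(L^\infty(M),\|\cdot\|_A)$ be a surjective linear isometry associated to $\psi$, that is, such that for some sign $\varepsilon_0\in\{\pm1\}$ one has $J_M(Tf)=\varepsilon_0\,(J_Kf)\circ\sigma_K\circ\psi\circ\pi_M$ on $M$ for every $f\in L^\infty(K)$. Then there exist $\varepsilon\in\{\pm1\}$ and an increasing lipeomorphism $\phi:M\to K$ with $\pi_K\circ\phi=\psi\circ\pi_M$ such that, for every $f\in L^\infty(K)$, $$(Tf)(y)=\varepsilon\,f(\phi(y))\,\tilde\phi'(y)\qquad\text{for a.e. }y\in M,$$ where $\tilde\phi:[\min M,\max M]\to[\min K,\max K]$ denotes the extension of $\phi$ which is affine on each gap of $M$; in particular, $\tilde\phi$ is differentiable at a.e. $y\in M$.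 -/

import Mathlib

open Set MeasureTheory

namespace Alexiewicz

noncomputable section

/-- The measure projection `π_K(x) = λ([min K, x] ∩ K)`. For nonempty compact `K`, `sInf K` and
`sSup K` are the minimum and the maximum of `K`. -/
def proj (K : Set ℝ) (x : ℝ) : ℝ := volume.real (Icc (sInf K) x ∩ K)

/-- The fiber `π_K⁻¹(t)`, a subset of `K`. -/
def fiber (K : Set ℝ) (t : ℝ) : Set ℝ := {x | x ∈ K ∧ proj K x = t}

/-- The selector `σ_K(t) = min π_K⁻¹(t)`. -/
def selector (K : Set ℝ) (t : ℝ) : ℝ := sInf (fiber K t)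

/-- The set `E_K` of those `t ∈ [0, |K|]` whose fiber has more than one point. -/
def excSet (K : Set ℝ) : Set ℝ := {t | t ∈ Icc 0 (volume.real K) ∧ (fiber K t).Nontrivial}

/-- The open interval `(l, r)` is a gap of `K`. -/
structure IsGap (K : Set ℝ) (l r : ℝ) : Prop where
  lt : l < r
  left_mem : l ∈ K
  right_mem : r ∈ K
  disjoint : Disjoint (Ioo l r) K

/-- `φ` restricts to an increasing bi-Lipschitz bijection (an increasing lipeomorphism)
from `A` onto `B`. Values of `φ` outside `A` are irrelevant. -/
structure IsIncreasingLipeo (φ : ℝ → ℝ) (A B : Set ℝ) : Prop where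
  bijOn : BijOn φ A B
  strictMonoOn : StrictMonoOn φ A
  lipschitz : ∃ L : NNReal, LipschitzOnWith L φ A
  inv_lipschitz : ∃ L : NNReal, ∀ x ∈ A, ∀ y ∈ A, |x - y| ≤ L * |φ x - φ y|

/-- `K` and `M` are fiber `ψ`-compatible. -/
def FiberCompatible (K M : Set ℝ) (ψ : ℝ → ℝ) : Prop :=
  ψ '' excSet M = excSet K ∧ ∀ s ∈ excSet M, Nonempty (fiber M s ≃o fiber K (ψ s))

/-- `K` and `M` are gap `ψ`-compatible. If `(l, r)` is a gap of `M` whose endpoints lie in the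
fiber over `s`, the corresponding gap of `K` via `h s` is `(h s l, h s r)`. -/
def GapCompatible (K M : Set ℝ) (ψ : ℝ → ℝ) : Prop :=
  FiberCompatible K M ψ ∧
  ∃ h : ∀ s : ℝ, s ∈ excSet M → (fiber M s ≃o fiber K (ψ s)),
  ∃ C : ℝ, 1 ≤ C ∧
    ∀ l r : ℝ, IsGap M l r →
    ∀ (s : ℝ) (hs : s ∈ excSet M) (hl : l ∈ fiber M s) (hr : r ∈ fiber M s),
      C⁻¹ ≤ volume.real (Ioo (h s hs ⟨l, hl⟩ : ℝ) (h s hs ⟨r, hr⟩ : ℝ)) / volume.real (Ioo l r) ∧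
      volume.real (Ioo (h s hs ⟨l, hl⟩ : ℝ) (h s hs ⟨r, hr⟩ : ℝ)) / volume.real (Ioo l r) ≤ C

/-- The real space `L^∞(K)` with respect to Lebesgue measure (as a vector space; the norm used
below is the Alexiewicz norm `normA`). -/
abbrev LInf (K : Set ℝ) : Type := Lp ℝ ⊤ (volume.restrict K)

/-- The primitive `J_K f(x) = ∫_{[min K, x] ∩ K} f dλ`. -/
def primitive (K : Set ℝ) (f : LInf K) (x : ℝ) : ℝ := ∫ t in Icc (sInf K) x ∩ K, f t

/-- The Alexiewicz norm `sup_{x ∈ K} |J_K f(x)|`. -/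
def normA (K : Set ℝ) (f : LInf K) : ℝ := ⨆ x : K, |primitive K f x|

/-- `T` is a surjective linear isometry from `(L^∞(K), ‖·‖_A)` onto `(L^∞(M), ‖·‖_A)`. -/
structure IsSurjIsometry (K M : Set ℝ) (T : LInf K →ₗ[ℝ] LInf M) : Prop where
  surjective : Function.Surjective T
  norm_map : ∀ f : LInf K, normA M (T f) = normA K f

/-- `T` is associated to `ψ`: for some sign `ε` one has
`J_M(T f) = ε (J_K f) ∘ (σ_K ∘ ψ ∘ π_M)` on `M` for every `f`. -/
def IsAssociated (K M : Set ℝ) (ψ : ℝ → ℝ) (T : LInf K →ₗ[ℝ] LInf M) : Prop :=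
  ∃ ε : ℝ, (ε = 1 ∨ ε = -1) ∧ ∀ f : LInf K, ∀ y ∈ M,
    primitive M (T f) y = ε * primitive K f (selector K (ψ (proj M y)))

open Classical in
/-- The extension of `φ : M → ℝ` to `[min M, max M]` which is affine on each gap of `M`: a point
`y ∉ M` lies in the gap `(l, r)` with `l = max (M ∩ (-∞, y])` and `r = min (M ∩ [y, ∞))`. -/
def gapAffineExt (M : Set ℝ) (φ : ℝ → ℝ) (y : ℝ) : ℝ :=
  if y ∈ M then φ y
  else
    φ (sSup (M ∩ Iic y)) +
      (y - sSup (M ∩ Iic y)) / (sInf (M ∩ Ici y) - sSup (M ∩ Iic y)) *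
        (φ (sInf (M ∩ Ici y)) - φ (sSup (M ∩ Iic y)))

theorem gapAffineExt_of_mem {M : Set ℝ} (φ : ℝ → ℝ) {y : ℝ} (hy : y ∈ M) :
    gapAffineExt M φ y = φ y := by
  simp [gapAffineExt, hy]

theorem gapAffineExt_of_gap {M : Set ℝ} (φ : ℝ → ℝ) {l r y : ℝ} (h : IsGap M l r)
    (hy : y ∈ Icc l r) :
    gapAffineExt M φ y = φ l + (y - l) / (r - l) * (φ r - φ l) := by
  have hne : r - l ≠ 0 := sub_ne_zero.mpr h.lt.ne'
  rcases eq_or_lt_of_le hy.1 with rfl | h1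
  · simp [gapAffineExt_of_mem φ h.left_mem]
  rcases eq_or_lt_of_le hy.2 with rfl | h2
  · rw [gapAffineExt_of_mem φ h.right_mem, div_self hne]; ring
  have hd : ∀ z ∈ M, ¬ (l < z ∧ z < r) := fun z hz hzz =>
    Set.disjoint_left.mp h.disjoint hzz hz
  have hyM : y ∉ M := fun hm => hd y hm ⟨h1, h2⟩
  have hl : sSup (M ∩ Iic y) = l := by
    refine IsGreatest.csSup_eq ⟨⟨h.left_mem, h1.le⟩, fun z hz => ?_⟩
    by_contra hc
    exact hd z hz.1 ⟨not_le.mp hc, lt_of_le_of_lt hz.2 h2⟩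
  have hr : sInf (M ∩ Ici y) = r := by
    refine IsLeast.csInf_eq ⟨⟨h.right_mem, h2.le⟩, fun z hz => ?_⟩
    by_contra hc
    exact hd z hz.1 ⟨lt_of_lt_of_le h1 hz.2, not_le.mp hc⟩
  simp [gapAffineExt, hyM, hl, hr]

end

end Alexiewicz

namespace Alexiewicz

variable {K M : Set ℝ}

/-! The map `φ` is glued from fibers. Over `s ∈ E_M` it is the given `h s`; elsewhere both fibers
are singletons matched by `ψ` (`exists_strictMonoOn_bijOn`). For `x ≤ y` in `M`, the length `y - x`
is the measure of the part in `M` plus the total length of the gaps between (`sub_eq_proj_add`).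
Under `φ` the first term is distorted by at most the Lipschitz constants of `ψ`, the second gap by
gap by at most `C`, so `φ` is bi-Lipschitz (`exists_increasingLipeo`).

Primitives are constant on fibers (`primitive_congr`), so `σ_K ∘ ψ ∘ π_M` may be replaced by `φ` in
the formula for `J_M (T f)`. A change of variables turns `J_K f ∘ φ` into the primitive of `(f ∘ φ)
· φ̃'`, and functions with equal primitives agree a.e. (`ae_eq_weighted_comp`). The derivative
exists a.e. because `φ̃` is monotone. -/

/-! ### Measure projection, fibers and gaps -/

theorem Icc_sInf_inter (hK : IsCompact K) (x : ℝ) : Icc (sInf K) x ∩ K = Iic x ∩ K := by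
  ext z
  exact ⟨fun h => ⟨h.1.2, h.2⟩, fun h => ⟨⟨csInf_le hK.bddBelow h.2, h.1⟩, h.2⟩⟩

theorem proj_eq (hK : IsCompact K) (x : ℝ) : proj K x = volume.real (Iic x ∩ K) := by
  rw [proj, Icc_sInf_inter hK]

theorem volume_inter_ne_top (hK : IsCompact K) (s : Set ℝ) : volume (s ∩ K) ≠ ⊤ :=
  ((measure_mono inter_subset_right).trans_lt hK.measure_lt_top).ne

theorem proj_sub (hK : IsCompact K) {x y : ℝ} (hxy : x ≤ y) :
    proj K y - proj K x = volume.real (Ioc x y ∩ K) := by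
  have hd : Disjoint (Iic x ∩ K) (Ioc x y ∩ K) :=
    (Iic_disjoint_Ioc le_rfl).mono inter_subset_left inter_subset_left
  rw [proj_eq hK, proj_eq hK, ← Iic_union_Ioc_eq_Iic hxy, union_inter_distrib_right,
    measureReal_union hd (measurableSet_Ioc.inter hK.measurableSet) (volume_inter_ne_top hK _)
      (volume_inter_ne_top hK _)]
  ring

theorem proj_mono (hK : IsCompact K) : Monotone (proj K) := fun x y hxy => by
  have := proj_sub hK hxy
  have h0 : 0 ≤ volume.real (Ioc x y ∩ K) := measureReal_nonneg
  linarith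

theorem proj_sub_le (hK : IsCompact K) {x y : ℝ} (hxy : x ≤ y) :
    proj K y - proj K x ≤ y - x := by
  rw [proj_sub hK hxy]
  refine (measureReal_mono inter_subset_left (by simp)).trans ?_
  simp [hxy]

theorem continuous_proj (hK : IsCompact K) : Continuous (proj K) := by
  refine LipschitzWith.continuous (K := 1) (LipschitzWith.of_le_add fun x y => ?_)
  rcases le_total x y with h | h
  · exact (proj_mono hK h).trans (by simp)
  · have := proj_sub_le hK h
    have := Real.dist_eq x y
    have := le_abs_self (x - y)
    linarith

theorem proj_mem_Icc (hK : IsCompact K) (x : ℝ) : proj K x ∈ Icc 0 (volume.real K) :=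
  ⟨measureReal_nonneg, measureReal_mono inter_subset_right hK.measure_lt_top.ne⟩

/-- Rounds a real number down to a point of `K` without changing the initial segment of `K` it cuts
off. -/
theorem proj_csSup_inter_Iic (hK : IsCompact K) {x : ℝ} (hne : (K ∩ Iic x).Nonempty) :
    sSup (K ∩ Iic x) ∈ K ∧ sSup (K ∩ Iic x) ≤ x ∧ Iic (sSup (K ∩ Iic x)) ∩ K = Iic x ∩ K := by
  have h := (hK.inter_right isClosed_Iic).sSup_mem hne
  refine ⟨h.1, h.2, ?_⟩
  ext z
  exact ⟨fun hz => ⟨mem_Iic.2 (le_trans (mem_Iic.1 hz.1) h.2), hz.2⟩,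
    fun hz => ⟨le_csSup (hK.inter_right isClosed_Iic).bddAbove ⟨hz.2, hz.1⟩, hz.2⟩⟩

theorem fiber_nonempty (hK : IsCompact K) (hne : K.Nonempty) {t : ℝ}
    (ht : t ∈ Icc 0 (volume.real K)) : (fiber K t).Nonempty := by
  have h0 : proj K (sInf K) = 0 := by
    rw [proj, Icc_self, measureReal_def, measure_mono_null inter_subset_left (by simp)]
    rfl
  have h1 : proj K (sSup K) = volume.real K := by
    rw [proj_eq hK]
    congr 1
    exact inter_eq_right.2 fun z hz => le_csSup hK.bddAbove hz
  have hle : sInf K ≤ sSup K := csInf_le_csSup hne hK.bddBelow hK.bddAbove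
  obtain ⟨x, hx, rfl⟩ := intermediate_value_Icc hle (continuous_proj hK).continuousOn
    (by rwa [h0, h1])
  obtain ⟨ha, -, hb⟩ := proj_csSup_inter_Iic hK (x := x) ⟨sInf K, hK.sInf_mem hne, hx.1⟩
  exact ⟨_, ha, by rw [proj_eq hK, hb, proj_eq hK]⟩

theorem exists_gap (hK : IsCompact K) {x y z : ℝ} (hx : x ∈ K) (hy : y ∈ K) (hz : z ∈ Icc x y)
    (hzK : z ∉ K) : ∃ a b, IsGap K a b ∧ x ≤ a ∧ b ≤ y ∧ z ∈ Ioo a b := by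
  have ha := (hK.inter_right isClosed_Iic).sSup_mem ⟨x, hx, mem_Iic.2 hz.1⟩
  have hb := (hK.inter_right isClosed_Ici).sInf_mem ⟨y, hy, mem_Ici.2 hz.2⟩
  have hau : ∀ w ∈ K, w ≤ z → w ≤ sSup (K ∩ Iic z) := fun w hw hwz =>
    le_csSup (hK.inter_right isClosed_Iic).bddAbove ⟨hw, hwz⟩
  have hbl : ∀ w ∈ K, z ≤ w → sInf (K ∩ Ici z) ≤ w := fun w hw hwz =>
    csInf_le (hK.inter_right isClosed_Ici).bddBelow ⟨hw, hwz⟩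
  set a := sSup (K ∩ Iic z)
  set b := sInf (K ∩ Ici z)
  have haz : a < z := lt_of_le_of_ne ha.2 fun h => hzK (h ▸ ha.1)
  have hzb : z < b := lt_of_le_of_ne hb.2 fun h => hzK (h ▸ hb.1)
  refine ⟨a, b, ⟨haz.trans hzb, ha.1, hb.1, disjoint_left.2 fun w hw hwK => ?_⟩,
    hau x hx hz.1, hbl y hy hz.2, haz, hzb⟩
  rcases le_total w z with h | h
  · exact (hau w hwK h).not_gt hw.1
  · exact (hbl w hwK h).not_gt hw.2

theorem IsGap.not_mem {l r z : ℝ} (h : IsGap K l r) (hz : z ∈ K) (h1 : l < z) : r ≤ z :=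
  not_lt.1 fun h2 => disjoint_left.1 h.disjoint ⟨h1, h2⟩ hz

/-- Beyond `l`, the set `K` meets `(l, r]` only in `r`. Hence every gap lies over a single
exceptional fiber, where the gap condition applies. -/
theorem IsGap.proj_eq (hK : IsCompact K) {l r : ℝ} (h : IsGap K l r) : proj K l = proj K r := by
  have h0 := proj_sub hK h.lt.le
  have : volume (Ioc l r ∩ K) = 0 := by
    refine measure_mono_null (t := {r}) ?_ (by simp)
    intro z hz
    exact le_antisymm hz.1.2 (h.not_mem hz.2 hz.1.1)
  rw [measureReal_def, this] at h0
  simp at h0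
  linarith

theorem isGap_image_iff {φ : ℝ → ℝ} (hb : BijOn φ M K) (hm : StrictMonoOn φ M) {l r : ℝ}
    (hl : l ∈ M) (hr : r ∈ M) : IsGap K (φ l) (φ r) ↔ IsGap M l r := by
  constructor
  · refine fun h => ⟨(hm.lt_iff_lt hl hr).1 h.lt, hl, hr, disjoint_left.2 fun z hz hzM => ?_⟩
    exact disjoint_left.1 h.disjoint ⟨hm hl hzM hz.1, hm hzM hr hz.2⟩ (hb.mapsTo hzM)
  · refine fun h => ⟨hm hl hr h.lt, hb.mapsTo hl, hb.mapsTo hr, disjoint_left.2 fun z hz hzK => ?_⟩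
    obtain ⟨w, hw, rfl⟩ := hb.surjOn hzK
    exact disjoint_left.1 h.disjoint ⟨(hm.lt_iff_lt hl hw).1 hz.1, (hm.lt_iff_lt hw hr).1 hz.2⟩ hw

/-! ### Length comparison through gaps -/

/-- Comparison of the total length of the gaps between two points and between their images. -/
theorem volume_Ioc_diff_le (hK : IsCompact K) {φ : ℝ → ℝ} (hb : BijOn φ M K)
    (hm : StrictMonoOn φ M) {C : ℝ} (hC : 0 ≤ C)
    (hgap : ∀ l r, IsGap M l r → φ r - φ l ≤ C * (r - l)) {x y : ℝ} (hx : x ∈ M) (hy : y ∈ M) :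
    volume (Ioc (φ x) (φ y) \ K) ≤ ENNReal.ofReal C * volume (Ioc x y \ M) := by
  let G : Set (ℝ × ℝ) := {p | IsGap M p.1 p.2 ∧ x ≤ p.1 ∧ p.2 ≤ y}
  have hdis : G.PairwiseDisjoint fun p => Ioo p.1 p.2 := by
    rintro ⟨a, b⟩ h ⟨a', b'⟩ h' hne
    refine disjoint_left.2 fun z hz hz' => hne ?_
    have hab : ∀ {a b a' b' : ℝ}, IsGap M a b → IsGap M a' b' → z ∈ Ioo a b → z ∈ Ioo a' b' →
        a ≤ a' ∧ b ≤ b' := fun {a b a' b'} h h' hz hz' =>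
      ⟨not_lt.1 fun hlt => (h'.not_mem h.left_mem hlt).not_gt (hz.1.trans hz'.2),
        h.not_mem h'.right_mem (hz.1.trans hz'.2)⟩
    have h1 := hab h.1 h'.1 hz hz'
    have h2 := hab h'.1 h.1 hz' hz
    exact Prod.ext (le_antisymm h1.1 h2.1) (le_antisymm h1.2 h2.2)
  have hcount : G.Countable := hdis.countable_of_isOpen (fun _ _ => isOpen_Ioo)
    fun p hp => nonempty_Ioo.2 hp.1.lt
  have hsub : Ioc (φ x) (φ y) \ K ⊆ ⋃ p ∈ G, Ioo (φ p.1) (φ p.2) := by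
    rintro z ⟨hz, hzK⟩
    obtain ⟨a, b, hab, hxa, hby, hzab⟩ :=
      exists_gap hK (hb.mapsTo hx) (hb.mapsTo hy) (Ioc_subset_Icc_self hz) hzK
    obtain ⟨l, hl, rfl⟩ := hb.surjOn hab.left_mem
    obtain ⟨r, hr, rfl⟩ := hb.surjOn hab.right_mem
    exact mem_iUnion₂.2 ⟨(l, r), ⟨(isGap_image_iff hb hm hl hr).1 hab,
      (hm.le_iff_le hx hl).1 hxa, (hm.le_iff_le hr hy).1 hby⟩, hzab⟩
  have hsub' : ⋃ p ∈ G, Ioo p.1 p.2 ⊆ Ioc x y \ M := by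
    refine iUnion₂_subset fun p hp z hz => ⟨⟨hp.2.1.trans_lt hz.1, hz.2.le.trans hp.2.2⟩, ?_⟩
    exact disjoint_left.1 hp.1.disjoint hz
  -- Subadditivity suffices for the image gaps; disjointness is needed only for the gaps of `M`.
  calc volume (Ioc (φ x) (φ y) \ K) ≤ volume (⋃ p ∈ G, Ioo (φ p.1) (φ p.2)) := measure_mono hsub
    _ ≤ ∑' p : G, volume (Ioo (φ p.1.1) (φ p.1.2)) := measure_biUnion_le _ hcount _
    _ ≤ ∑' p : G, ENNReal.ofReal C * volume (Ioo p.1.1 p.1.2) := by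
      refine ENNReal.tsum_le_tsum fun p => ?_
      rw [Real.volume_Ioo, Real.volume_Ioo, ← ENNReal.ofReal_mul hC]
      exact ENNReal.ofReal_le_ofReal (hgap _ _ p.2.1)
    _ = ENNReal.ofReal C * volume (⋃ p ∈ G, Ioo p.1 p.2) := by
      rw [ENNReal.tsum_mul_left, measure_biUnion hcount hdis fun _ _ => measurableSet_Ioo]
    _ ≤ _ := by gcongr

theorem sub_eq_proj_add (hK : IsCompact K) {x y : ℝ} (hxy : x ≤ y) :
    y - x = (proj K y - proj K x) + volume.real (Ioc x y \ K) := by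
  rw [proj_sub hK hxy, measureReal_inter_add_sdiff hK.measurableSet (by simp)]
  simp [hxy]

/-- An increasing bijection which is Lipschitz on gaps and Lipschitz with respect to the measure
coordinates is Lipschitz. -/
theorem sub_le_of_gap (hK : IsCompact K) (hM : IsCompact M) {φ : ℝ → ℝ} (hb : BijOn φ M K)
    (hm : StrictMonoOn φ M) {C : ℝ} (hC : 0 ≤ C)
    (hgap : ∀ l r, IsGap M l r → φ r - φ l ≤ C * (r - l))
    (hproj : ∀ x ∈ M, ∀ y ∈ M, x ≤ y →
      proj K (φ y) - proj K (φ x) ≤ C * (proj M y - proj M x)) {x y : ℝ} (hx : x ∈ M)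
    (hy : y ∈ M) (hxy : x ≤ y) : φ y - φ x ≤ C * (y - x) := by
  have h := volume_Ioc_diff_le hK hb hm hC hgap hx hy
  have hfin : volume (Ioc x y \ M) ≠ ⊤ :=
    ((measure_mono sdiff_subset).trans_lt (by simp : volume (Ioc x y) < ⊤)).ne
  have h' := ENNReal.toReal_mono (ENNReal.mul_ne_top (by simp) hfin) h
  rw [ENNReal.toReal_mul, ENNReal.toReal_ofReal hC] at h'
  rw [sub_eq_proj_add hM hxy, sub_eq_proj_add hK (hm.monotoneOn hx hy hxy), mul_add]
  exact add_le_add (hproj x hx y hy hxy) h'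

/-! ### The gap-affine extension -/

theorem gapAffineExt_monotoneOn (hM : IsCompact M) (hne : M.Nonempty) {φ : ℝ → ℝ}
    (hm : MonotoneOn φ M) : MonotoneOn (gapAffineExt M φ) (Icc (sInf M) (sSup M)) := by
  have key : ∀ {l r z}, IsGap M l r → z ∈ Icc l r →
      gapAffineExt M φ z ∈ Icc (φ l) (φ r) := by
    intro l r z h hz
    rw [gapAffineExt_of_gap φ h hz]
    have h0 : 0 ≤ φ r - φ l := sub_nonneg.2 (hm h.left_mem h.right_mem h.lt.le)
    have h1 : 0 < r - l := sub_pos.2 h.lt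
    have h2 : 0 ≤ (z - l) / (r - l) := div_nonneg (sub_nonneg.2 hz.1) h1.le
    have h3 : (z - l) / (r - l) ≤ 1 := (div_le_one h1).2 (by linarith [hz.2])
    constructor <;> nlinarith
  have hmem : ∀ {x y}, x ∈ M → y ∈ Icc (sInf M) (sSup M) → x ≤ y →
      φ x ≤ gapAffineExt M φ y := by
    intro x y hx hy hxy
    by_cases hyM : y ∈ M
    · rw [gapAffineExt_of_mem φ hyM]; exact hm hx hyM hxy
    · obtain ⟨a, b, hab, hxa, -, hyab⟩ := exists_gap hM hx (hM.sSup_mem hne) ⟨hxy, hy.2⟩ hyM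
      exact (hm hx hab.left_mem hxa).trans (key hab (Ioo_subset_Icc_self hyab)).1
  intro x hx y hy hxy
  by_cases hxM : x ∈ M
  · rw [gapAffineExt_of_mem φ hxM]; exact hmem hxM hy hxy
  obtain ⟨a, b, hab, -, -, hxab⟩ := exists_gap hM (hM.sInf_mem hne) (hM.sSup_mem hne) hx hxM
  have hxI := Ioo_subset_Icc_self hxab
  rcases le_total b y with hby | hyb
  · exact (key hab hxI).2.trans (hmem hab.right_mem hy hby)
  · rw [gapAffineExt_of_gap φ hab hxI, gapAffineExt_of_gap φ hab ⟨hxI.1.trans hxy, hyb⟩]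
    have h0 : 0 ≤ φ b - φ a := sub_nonneg.2 (hm hab.left_mem hab.right_mem hab.lt.le)
    have h1 : 0 < b - a := sub_pos.2 hab.lt
    gcongr

theorem gapAffineExt_ae_differentiableAt (hM : IsCompact M) (hne : M.Nonempty) {φ : ℝ → ℝ}
    (hm : MonotoneOn φ M) :
    ∀ᵐ y ∂(volume.restrict M), DifferentiableAt ℝ (gapAffineExt M φ) y := by
  rw [ae_restrict_iff' hM.measurableSet]
  filter_upwards [(gapAffineExt_monotoneOn hM hne hm).ae_differentiableWithinAt_of_mem,
    Measure.ae_ne volume (sInf M), Measure.ae_ne volume (sSup M)] with y hy h1 h2 hyM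
  have ha := csInf_le hM.bddBelow hyM
  have hb := le_csSup hM.bddAbove hyM
  exact (hy ⟨ha, hb⟩).differentiableAt
    (Icc_mem_nhds (lt_of_le_of_ne ha h1.symm) (lt_of_le_of_ne hb h2))

/-! ### Null sets and change of variables -/

theorem ae_eq_zero_of_setIntegral_Iic {h : ℝ → ℝ} (hh : Integrable h)
    (h0 : ∀ y, ∫ t in Iic y, h t = 0) : h =ᵐ[volume] 0 := by
  filter_upwards [LocallyIntegrable.ae_hasDerivAt_integral hh.locallyIntegrable] with x hx
  have h1 := hx 0
  have : (fun y => ∫ t in (0 : ℝ)..y, h t) = fun _ => 0 := by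
    funext y
    rw [← intervalIntegral.integral_Iic_sub_Iic hh.integrableOn hh.integrableOn, h0, h0, sub_zero]
  rw [this] at h1
  exact h1.unique (hasDerivAt_const _ _)

/-- Lebesgue measure on the line is one-dimensional Hausdorff measure, which a Lipschitz map scales
by at most `L`. -/
theorem volume_image_eq_zero {φ : ℝ → ℝ} {L : NNReal} {s : Set ℝ} (h : LipschitzOnWith L φ s)
    (hs : volume s = 0) : volume (φ '' s) = 0 := by
  have := h.hausdorffMeasure_image_le zero_le_one
  rw [hausdorffMeasure_real, hs, mul_zero] at this
  exact nonpos_iff_eq_zero.1 this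

/-- Change of variables for a monotone Lipschitz function with an a.e. differentiable extension. -/
theorem integral_image_of_monotoneOn_of_lipschitzOn {φ F : ℝ → ℝ} {s : Set ℝ}
    (hs : MeasurableSet s) (hF : EqOn F φ s) (hm : MonotoneOn φ s) {L : NNReal}
    (hL : LipschitzOnWith L φ s) (hd : ∀ᵐ t ∂(volume.restrict s), DifferentiableAt ℝ F t)
    {g : ℝ → ℝ} (hg : IntegrableOn g (φ '' s)) :
    IntegrableOn (fun t => g (φ t) * deriv F t) s ∧
      ∫ t in s, g (φ t) * deriv F t = ∫ t in φ '' s, g t := by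
  -- Work on the differentiability points: the discarded part is null, and so is its image because
  -- `φ` is Lipschitz.
  set N := s ∩ {t | DifferentiableAt ℝ F t} with hN
  have hNm : MeasurableSet N := hs.inter (measurableSet_of_differentiableAt ℝ F)
  have hNs : N ⊆ s := inter_subset_left
  have h0 : volume (s \ N) = 0 := by
    rw [ae_restrict_iff' hs, ae_iff] at hd
    exact measure_mono_null (t := {t | ¬(t ∈ s → DifferentiableAt ℝ F t)})
      (fun t ht hc => ht.2 ⟨ht.1, hc ht.1⟩) hd
  have hae : (N : Set ℝ) =ᵐ[volume] s := by
    refine (ae_le_set.2 ?_).antisymm (ae_le_set.2 h0)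
    simp [sdiff_eq_empty.2 hNs]
  have hae' : (F '' N : Set ℝ) =ᵐ[volume] φ '' s := by
    rw [(hF.mono hNs).image_eq]
    refine (ae_le_set.2 ?_).antisymm (ae_le_set.2 ?_)
    · rw [sdiff_eq_empty.2 (image_mono hNs), measure_empty]
    · exact measure_mono_null (t := φ '' (s \ N)) (by
        rintro _ ⟨⟨t, ht, rfl⟩, hn⟩
        exact ⟨t, ⟨ht, fun hc => hn ⟨t, hc, rfl⟩⟩, rfl⟩)
        (volume_image_eq_zero (hL.mono sdiff_subset) h0)
  have hder : ∀ t ∈ N, HasDerivWithinAt F (deriv F t) N t :=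
    fun t ht => ht.2.hasDerivAt.hasDerivWithinAt
  have hmN : MonotoneOn F N := fun a ha b hb hab => by
    rw [hF (hNs ha), hF (hNs hb)]; exact hm (hNs ha) (hNs hb) hab
  have hcongr : EqOn (fun t => deriv F t • g (F t)) (fun t => g (φ t) * deriv F t) N := by
    intro t ht
    simp only [smul_eq_mul, hF (hNs ht), mul_comm]
  constructor
  · rw [← integrableOn_congr_set_ae hae, ← integrableOn_congr_fun hcongr hNm,
      ← integrableOn_image_iff_integrableOn_deriv_smul_of_monotoneOn hNm hder hmN,
      integrableOn_congr_set_ae hae']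
    exact hg
  · rw [← setIntegral_congr_set hae, ← setIntegral_congr_fun hNm hcongr,
      ← integral_image_eq_integral_deriv_smul_of_monotoneOn hNm hder hmN,
      setIntegral_congr_set hae']

/-! ### Primitives -/

theorem primitive_eq (hK : IsCompact K) (f : LInf K) (x : ℝ) :
    primitive K f x = ∫ t in Iic x ∩ K, f t := by
  rw [primitive, Icc_sInf_inter hK]

/-- Two points with the same projection are separated by a null piece of `K`. -/
theorem primitive_congr (hK : IsCompact K) (f : LInf K) {x y : ℝ} (h : proj K x = proj K y) :
    primitive K f x = primitive K f y := by
  wlog hxy : x ≤ y generalizing x y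
  · exact (this h.symm (le_of_not_ge hxy)).symm
  have h0 := proj_sub hK hxy
  rw [h, sub_self, eq_comm, measureReal_eq_zero_iff (volume_inter_ne_top hK _)] at h0
  rw [primitive_eq hK, primitive_eq hK, ← Iic_union_Ioc_eq_Iic hxy, union_inter_distrib_right]
  exact (setIntegral_congr_set (union_ae_eq_left_of_ae_eq_empty (ae_eq_empty.2 h0))).symm

theorem integrableOn_LInf (hK : IsCompact K) (f : LInf K) : IntegrableOn f K := by
  have : IsFiniteMeasure (volume.restrict K) := ⟨by simpa using hK.measure_lt_top⟩
  exact (Lp.memLp f).integrable le_top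

theorem ae_eq_of_primitive_eq (hM : IsCompact M) {u v : ℝ → ℝ} (hu : IntegrableOn u M)
    (hv : IntegrableOn v M)
    (h : ∀ y ∈ M, ∫ t in Iic y ∩ M, u t = ∫ t in Iic y ∩ M, v t) :
    u =ᵐ[volume.restrict M] v := by
  have key := ae_eq_zero_of_setIntegral_Iic (h := M.indicator (u - v))
    ((hu.sub hv).integrable_indicator hM.measurableSet) fun y => by
      rw [setIntegral_indicator hM.measurableSet]
      rcases (M ∩ Iic y).eq_empty_or_nonempty with he | hne
      · rw [inter_comm, he]; simp
      · obtain ⟨ha, -, hb⟩ := proj_csSup_inter_Iic hM hne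
        have := h _ ha
        rw [hb] at this
        rw [← sub_eq_zero, ← integral_sub (hu.mono_set inter_subset_right)
          (hv.mono_set inter_subset_right)] at this
        exact this
  rw [Filter.EventuallyEq, ae_restrict_iff' hM.measurableSet]
  filter_upwards [key] with t ht htM
  rw [indicator_of_mem htM] at ht
  exact sub_eq_zero.1 ht

/-- An increasing bijection carries initial segments of `M` onto initial segments of `K`, so the
change of variables matches the primitives at every point of `M`. -/
theorem ae_eq_weighted_comp (hK : IsCompact K) (hM : IsCompact M) {φ F : ℝ → ℝ}
    (hφ : IsIncreasingLipeo φ M K) (hF : EqOn F φ M)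
    (hd : ∀ᵐ t ∂(volume.restrict M), DifferentiableAt ℝ F t) {ε : ℝ} {f : LInf K} {k : LInf M}
    (h : ∀ y ∈ M, primitive M k y = ε * primitive K f (φ y)) {g : ℝ → ℝ}
    (hg : g =ᵐ[volume.restrict K] f) :
    ∀ᵐ y ∂(volume.restrict M), k y = ε * g (φ y) * deriv F y := by
  obtain ⟨L, hL⟩ := hφ.lipschitz
  have hgi : IntegrableOn g K := (integrableOn_LInf hK f).congr hg.symm
  have hcov := fun (s : Set ℝ) (hs : MeasurableSet s) (hsM : s ⊆ M) =>
    integral_image_of_monotoneOn_of_lipschitzOn hs (hF.mono hsM)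
      (hφ.strictMonoOn.monotoneOn.mono hsM) (hL.mono hsM) (ae_restrict_of_ae_restrict_of_subset hsM hd)
      (hgi.mono_set ((image_mono hsM).trans hφ.bijOn.image_eq.subset))
  have himg : ∀ y ∈ M, φ '' (Iic y ∩ M) = Iic (φ y) ∩ K := by
    intro y hy
    ext z
    constructor
    · rintro ⟨w, hw, rfl⟩
      exact ⟨hφ.strictMonoOn.monotoneOn hw.2 hy hw.1, hφ.bijOn.mapsTo hw.2⟩
    · rintro ⟨hz, hzK⟩
      obtain ⟨w, hw, rfl⟩ := hφ.bijOn.surjOn hzK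
      exact ⟨w, ⟨(hφ.strictMonoOn.le_iff_le hw hy).1 hz, hw⟩, rfl⟩
  have hint := (hcov M hM.measurableSet Subset.rfl).1.const_mul ε
  refine (ae_eq_of_primitive_eq hM (integrableOn_LInf hM k) hint fun y hy => ?_).trans
    (.of_forall fun y => (mul_assoc _ _ _).symm)
  have h1 := (hcov (Iic y ∩ M) (measurableSet_Iic.inter hM.measurableSet) inter_subset_right).2
  rw [integral_const_mul, h1, himg y hy, ← primitive_eq hM, h y hy, primitive_eq hK]
  congr 1
  exact (integral_congr_ae (ae_restrict_of_ae_restrict_of_subset inter_subset_right hg)).symm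

/-! ### Construction of the lipeomorphism -/

theorem selector_mem_fiber (hK : IsCompact K) {t : ℝ} (hne : (fiber K t).Nonempty) :
    selector K t ∈ fiber K t :=
  (hK.inter_right (isClosed_singleton.preimage (continuous_proj hK) :
    IsClosed (proj K ⁻¹' {t}))).sInf_mem hne

theorem strictMonoOn_invFunOn {φ : ℝ → ℝ} (hb : BijOn φ M K) (hm : StrictMonoOn φ M) :
    StrictMonoOn (Function.invFunOn φ M) K := by
  intro a ha b hb' hab
  obtain ⟨x, hx, rfl⟩ := hb.surjOn ha
  obtain ⟨y, hy, rfl⟩ := hb.surjOn hb'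
  rw [hb.invOn_invFunOn.1 hx, hb.invOn_invFunOn.1 hy]
  exact (hm.lt_iff_lt hx hy).1 hab

/-- A strictly increasing bijection is bi-Lipschitz when its increments over gaps and its
increments in measure coordinates are comparable to those of the identity. -/
theorem isIncreasingLipeo_of_gap (hK : IsCompact K) (hM : IsCompact M) {φ : ℝ → ℝ}
    (hb : BijOn φ M K) (hm : StrictMonoOn φ M) {C : ℝ} (hC : 0 ≤ C)
    (hgap : ∀ l r, IsGap M l r → φ r - φ l ≤ C * (r - l) ∧ r - l ≤ C * (φ r - φ l))
    (hproj : ∀ x ∈ M, ∀ y ∈ M, x ≤ y →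
      proj K (φ y) - proj K (φ x) ≤ C * (proj M y - proj M x) ∧
      proj M y - proj M x ≤ C * (proj K (φ y) - proj K (φ x))) :
    IsIncreasingLipeo φ M K := by
  -- The lower bound for `φ` is the upper bound for its inverse `θ`, by the symmetric argument.
  set θ := Function.invFunOn φ M
  have hθφ : LeftInvOn θ φ M := hb.invOn_invFunOn.1
  have hθ : BijOn θ K M := hb.symm hb.invOn_invFunOn.symm
  have hθm : StrictMonoOn θ K := strictMonoOn_invFunOn hb hm
  have h1 : ∀ x ∈ M, ∀ y ∈ M, x ≤ y → φ y - φ x ≤ C * (y - x) := fun x hx y hy hxy =>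
    sub_le_of_gap hK hM hb hm hC (fun l r h => (hgap l r h).1)
      (fun x hx y hy h => (hproj x hx y hy h).1) hx hy hxy
  have h2 : ∀ x ∈ M, ∀ y ∈ M, x ≤ y → y - x ≤ C * (φ y - φ x) := by
    intro x hx y hy hxy
    have := sub_le_of_gap hM hK hθ hθm hC (fun a b hab => ?_) (fun a ha b hb' hab => ?_)
      (hb.mapsTo hx) (hb.mapsTo hy) (hm.monotoneOn hx hy hxy)
    · rwa [hθφ hx, hθφ hy] at this
    · obtain ⟨l, hl, rfl⟩ := hb.surjOn hab.left_mem
      obtain ⟨r, hr, rfl⟩ := hb.surjOn hab.right_mem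
      rw [hθφ hl, hθφ hr]
      exact (hgap l r ((isGap_image_iff hb hm hl hr).1 hab)).2
    · obtain ⟨l, hl, rfl⟩ := hb.surjOn ha
      obtain ⟨r, hr, rfl⟩ := hb.surjOn hb'
      rw [hθφ hl, hθφ hr]
      exact (hproj l hl r hr ((hm.le_iff_le hl hr).1 hab)).2
  refine ⟨hb, hm, ⟨C.toNNReal, ?_⟩, ⟨C.toNNReal, ?_⟩⟩
  · refine LipschitzOnWith.of_dist_le_mul fun x hx y hy => ?_
    rw [Real.coe_toNNReal C hC]
    wlog hxy : x ≤ y generalizing x y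
    · rw [dist_comm, dist_comm x]; exact this y hy x hx (le_of_not_ge hxy)
    rw [dist_comm, dist_comm x, Real.dist_eq, Real.dist_eq,
      abs_of_nonneg (sub_nonneg.2 (hm.monotoneOn hx hy hxy)), abs_of_nonneg (sub_nonneg.2 hxy)]
    exact h1 x hx y hy hxy
  · intro x hx y hy
    rw [Real.coe_toNNReal C hC]
    wlog hxy : x ≤ y generalizing x y
    · rw [abs_sub_comm, abs_sub_comm (φ x)]; exact this y hy x hx (le_of_not_ge hxy)
    rw [abs_sub_comm, abs_sub_comm (φ x),
      abs_of_nonneg (sub_nonneg.2 (hm.monotoneOn hx hy hxy)), abs_of_nonneg (sub_nonneg.2 hxy)]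
    exact h2 x hx y hy hxy

/-- Gluing order isomorphisms of the exceptional fibers gives an increasing bijection. -/
theorem exists_strictMonoOn_bijOn (hK : IsCompact K) (hM : IsCompact M) (hKne : K.Nonempty)
    (hMne : M.Nonempty) {ψ : ℝ → ℝ}
    (hψ : BijOn ψ (Icc 0 (volume.real M)) (Icc 0 (volume.real K)))
    (hψm : StrictMonoOn ψ (Icc 0 (volume.real M))) (hE : ψ '' excSet M = excSet K)
    (h : ∀ s : ℝ, s ∈ excSet M → (fiber M s ≃o fiber K (ψ s))) :
    ∃ φ : ℝ → ℝ, BijOn φ M K ∧ StrictMonoOn φ M ∧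
      (∀ y ∈ M, proj K (φ y) = ψ (proj M y)) ∧
      ∀ (s : ℝ) (hs : s ∈ excSet M) (y : ℝ) (hy : y ∈ fiber M s), φ y = h s hs ⟨y, hy⟩ := by
  classical
  let φ : ℝ → ℝ := fun y => if hy : y ∈ M ∧ proj M y ∈ excSet M then
    (h (proj M y) hy.2 ⟨y, hy.1, rfl⟩ : ℝ) else selector K (ψ (proj M y))
  have hexc : ∀ (s : ℝ) (hs : s ∈ excSet M) (y : ℝ) (hy : y ∈ fiber M s),
      φ y = h s hs ⟨y, hy⟩ := by
    rintro s hs y ⟨hyM, rfl⟩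
    exact dif_pos ⟨hyM, hs⟩
  have hsel : ∀ y, proj M y ∉ excSet M → φ y = selector K (ψ (proj M y)) :=
    fun y hy => dif_neg fun hc => hy hc.2
  have hmem : ∀ y ∈ M, φ y ∈ fiber K (ψ (proj M y)) := by
    intro y hy
    by_cases hs : proj M y ∈ excSet M
    · rw [hexc _ hs y ⟨hy, rfl⟩]
      exact Subtype.prop _
    · rw [hsel y hs]
      exact selector_mem_fiber hK (fiber_nonempty hK hKne (hψ.mapsTo (proj_mem_Icc hM y)))
  have hmono : StrictMonoOn φ M := by
    intro x hx y hy hxy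
    rcases (proj_mono hM hxy.le).eq_or_lt with he | hlt
    · have hs : proj M y ∈ excSet M :=
        ⟨proj_mem_Icc hM y, x, ⟨hx, he⟩, y, ⟨hy, rfl⟩, hxy.ne⟩
      rw [hexc _ hs x ⟨hx, he⟩, hexc _ hs y ⟨hy, rfl⟩]
      exact (h _ hs).lt_iff_lt.2 hxy
    · refine lt_of_not_ge fun hc => (proj_mono hK hc).not_gt ?_
      rw [(hmem x hx).2, (hmem y hy).2]
      exact hψm (proj_mem_Icc hM x) (proj_mem_Icc hM y) hlt
  refine ⟨φ, ⟨fun y hy => (hmem y hy).1, hmono.injOn, fun k hk => ?_⟩, hmono,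
    fun y hy => (hmem y hy).2, hexc⟩
  obtain ⟨s, hs, hsk⟩ := hψ.surjOn (proj_mem_Icc hK k)
  by_cases hse : s ∈ excSet M
  · obtain ⟨⟨y, hy⟩, hyk⟩ := (h s hse).surjective ⟨k, hk, hsk.symm⟩
    exact ⟨y, hy.1, by rw [hexc s hse y hy, hyk]⟩
  · obtain ⟨y, hyM, rfl⟩ := fiber_nonempty hM hMne hs
    refine ⟨y, hyM, ?_⟩
    -- A second point in the fiber over `ψ (proj M y)` would put this value in `excSet K = ψ ''
    -- excSet M`, and injectivity of `ψ` would make `proj M y` exceptional.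
    by_contra hne
    have hk' : ψ (proj M y) ∈ excSet K :=
      ⟨hψ.mapsTo hs, φ y, hmem y hyM, k, ⟨hk, hsk.symm⟩, hne⟩
    rw [← hE] at hk'
    obtain ⟨s', hs', he⟩ := hk'
    exact hse (hψ.injOn hs'.1 hs he ▸ hs')

theorem exists_increasingLipeo (hK : IsCompact K) (hM : IsCompact M) (hKne : K.Nonempty)
    (hMne : M.Nonempty) {ψ : ℝ → ℝ}
    (hψ : IsIncreasingLipeo ψ (Icc 0 (volume.real M)) (Icc 0 (volume.real K)))
    (hgap : GapCompatible K M ψ) :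
    ∃ φ : ℝ → ℝ, IsIncreasingLipeo φ M K ∧ ∀ y ∈ M, proj K (φ y) = ψ (proj M y) := by
  obtain ⟨⟨hE, -⟩, h, C, hC, hgapC⟩ := hgap
  obtain ⟨φ, hb, hm, hp, hφ⟩ :=
    exists_strictMonoOn_bijOn hK hM hKne hMne hψ.bijOn hψ.strictMonoOn hE h
  obtain ⟨L, hL⟩ := hψ.lipschitz
  obtain ⟨L', hL'⟩ := hψ.inv_lipschitz
  have hC0 : 0 < C := by linarith
  -- One constant serving gaps and projections in both directions.
  set D : ℝ := max C (max L L')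
  have hCD : C ≤ D := le_max_left _ _
  have hLD : (L : ℝ) ≤ D := (le_max_left _ _).trans (le_max_right _ _)
  have hLD' : (L' : ℝ) ≤ D := (le_max_right _ _).trans (le_max_right _ _)
  refine ⟨φ, isIncreasingLipeo_of_gap hK hM hb hm (hC0.le.trans hCD) (fun l r hlr => ?_)
    (fun x hx y hy hxy => ?_), hp⟩
  · have hlf : l ∈ fiber M (proj M r) := ⟨hlr.left_mem, hlr.proj_eq hM⟩
    have hrf : r ∈ fiber M (proj M r) := ⟨hlr.right_mem, rfl⟩
    have hs : proj M r ∈ excSet M := ⟨proj_mem_Icc hM r, l, hlf, r, hrf, hlr.lt.ne⟩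
    have hG := hgapC l r hlr _ hs hlf hrf
    have hφlr : 0 < φ r - φ l := sub_pos.2 (hm hlr.left_mem hlr.right_mem hlr.lt)
    have hlr0 : 0 < r - l := sub_pos.2 hlr.lt
    rw [← hφ _ hs l hlf, ← hφ _ hs r hrf, Real.volume_real_Ioo_of_le (sub_pos.1 hφlr).le,
      Real.volume_real_Ioo_of_le hlr.lt.le, le_div_iff₀ hlr0, div_le_iff₀ hlr0,
      inv_mul_le_iff₀ hC0] at hG
    exact ⟨hG.2.trans (by gcongr), hG.1.trans (by gcongr)⟩
  · rw [hp x hx, hp y hy]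
    have hxI := proj_mem_Icc hM x
    have hyI := proj_mem_Icc hM y
    have hle := proj_mono hM hxy
    have hle' := hψ.strictMonoOn.monotoneOn hxI hyI hle
    have h1 := hL.dist_le_mul _ hyI _ hxI
    have h2 := hL' _ hyI _ hxI
    rw [Real.dist_eq, Real.dist_eq, abs_of_nonneg (sub_nonneg.2 hle'),
      abs_of_nonneg (sub_nonneg.2 hle)] at h1
    rw [abs_of_nonneg (sub_nonneg.2 hle'), abs_of_nonneg (sub_nonneg.2 hle)] at h2
    exact ⟨h1.trans (mul_le_mul_of_nonneg_right hLD (sub_nonneg.2 hle)),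
      h2.trans (mul_le_mul_of_nonneg_right hLD' (sub_nonneg.2 hle'))⟩

theorem mapsTo_gapAffineExt (hK : IsCompact K) (hM : IsCompact M) (hne : M.Nonempty) {φ : ℝ → ℝ}
    (hm : MonotoneOn φ M) (hφ : MapsTo φ M K) :
    MapsTo (gapAffineExt M φ) (Icc (sInf M) (sSup M)) (Icc (sInf K) (sSup K)) := by
  intro y hy
  have hle := csInf_le_csSup hne hM.bddBelow hM.bddAbove
  have hmono := gapAffineExt_monotoneOn hM hne hm
  have h1 := hmono (left_mem_Icc.2 hle) hy hy.1
  have h2 := hmono hy (right_mem_Icc.2 hle) hy.2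
  rw [gapAffineExt_of_mem φ (hM.sInf_mem hne)] at h1
  rw [gapAffineExt_of_mem φ (hM.sSup_mem hne)] at h2
  exact ⟨(csInf_le hK.bddBelow (hφ (hM.sInf_mem hne))).trans h1,
    h2.trans (le_csSup hK.bddAbove (hφ (hM.sSup_mem hne)))⟩

end Alexiewicz

theorem corollary5p5 (K M : Set ℝ) (hK : IsCompact K) (hM : IsCompact M)
    (hK0 : 0 < volume K) (hM0 : 0 < volume M)
    (ψ : ℝ → ℝ)
    (hψ : Alexiewicz.IsIncreasingLipeo ψ (Icc 0 (volume.real M)) (Icc 0 (volume.real K)))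
    (hgap : Alexiewicz.GapCompatible K M ψ)
    (T : Alexiewicz.LInf K →ₗ[ℝ] Alexiewicz.LInf M)
    (hT : Alexiewicz.IsSurjIsometry K M T)
    (hTψ : Alexiewicz.IsAssociated K M ψ T) :
    ∃ (ε : ℝ) (φ : ℝ → ℝ), (ε = 1 ∨ ε = -1) ∧
      Alexiewicz.IsIncreasingLipeo φ M K ∧
      (∀ y ∈ M, Alexiewicz.proj K (φ y) = ψ (Alexiewicz.proj M y)) ∧
      MapsTo (Alexiewicz.gapAffineExt M φ) (Icc (sInf M) (sSup M)) (Icc (sInf K) (sSup K)) ∧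
      (∀ᵐ y ∂(volume.restrict M), DifferentiableAt ℝ (Alexiewicz.gapAffineExt M φ) y) ∧
      -- the formula holds for every representative `g` of the class `f`
      ∀ (f : Alexiewicz.LInf K) (g : ℝ → ℝ), g =ᵐ[volume.restrict K] f →
        ∀ᵐ y ∂(volume.restrict M),
          T f y = ε * g (φ y) * deriv (Alexiewicz.gapAffineExt M φ) y := by
  have hKne : K.Nonempty := nonempty_of_measure_ne_zero hK0.ne'
  have hMne : M.Nonempty := nonempty_of_measure_ne_zero hM0.ne'
  obtain ⟨φ, hφ, hp⟩ := Alexiewicz.exists_increasingLipeo hK hM hKne hMne hψ hgap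
  obtain ⟨ε, hε, hA⟩ := hTψ
  have hd := Alexiewicz.gapAffineExt_ae_differentiableAt hM hMne hφ.strictMonoOn.monotoneOn
  refine ⟨ε, φ, hε, hφ, hp, Alexiewicz.mapsTo_gapAffineExt hK hM hMne hφ.strictMonoOn.monotoneOn
    hφ.bijOn.mapsTo, hd, fun f g hg => ?_⟩
  refine Alexiewicz.ae_eq_weighted_comp hK hM hφ
    (fun y hy => Alexiewicz.gapAffineExt_of_mem φ hy) hd (fun y hy => ?_) hg
  rw [hA f y hy]
  congr 1
  have hmem : φ y ∈ Alexiewicz.fiber K (ψ (Alexiewicz.proj M y)) :=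
    ⟨hφ.bijOn.mapsTo hy, hp y hy⟩
  exact Alexiewicz.primitive_congr hK f
    ((Alexiewicz.selector_mem_fiber hK ⟨_, hmem⟩).2.trans hmem.2.symm)
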